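/- Let $n\ge 1$ be an integer and let $\mathcal P_n$ be the $(n+1)$-dimensional complex vector space of all polynomials of degree at most $n$. Let $D:\mathcal P_n\to\mathcal P_n$ be differentiation, and let $\mathcal D(\mathcal P_n)$ be the linear span of $I, D,\dots,D^n$ in the algebra $\mathcal L(\mathcal P_n)$ of linear operators on $\mathcal P_n$. For $f\ne0$ let $Z(f)$ be the multiset of complex roots of $f$, counted with multiplicity (regarded as a set, except in the definition of $d_F$ below), and let $Z(0)=\mathbb C$. For non-empty finite $A,B\subset\mathbb C$ put $$d_m(A,B)=\min_{x\in A,\,y\in B}|x-y|,\qquad d_h(A,B)=\max_{y\in B}\min_{x\in A}|x-y|,\qquad d_H(A,B)=\max\{d_h(A,B),d_h(B,A)\}.$$ For $d\in\{d_m,d_h,d_H\}$ put $d(\emptyset,\emptyset)=0$, $d(A,\emptyset)=d(\emptyset,A)=+\infty$ if $A\neq\emptyset$, and $d(A,\mathbb C)=d(\mathbb C,A)=0$ if $A\ne\emptyset$. For multisets $U=\{u_1,\dots,u_m\}$ and $V=\{v_1,\dots,v_m\}$ of the same size $m\geq 1$ put $d_F(U,V)=\min_{\sigma}\max_{k}|u_k-v_{\sigma(k)}|$,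 where $\sigma$ runs over the permutations of $\{1,\dots,m\}$. For $T\in\mathcal L(\mathcal P_n)$ and $*\in\{m,h,H\}$ let $K_*(T)=\sup\{d_*(Z(f),Z(Tf)): f\in\mathcal P_n\}\in[0,+\infty]$. If $\deg(Tf)=\deg (f)$ for all $f\in\mathcal P_n$, let $K_F(T)=\sup\{d_F(Z(f),Z(Tf)): f\in\mathcal P_n \text{ non-constant}\}$. A circular domain is an open or closed disc of positive radius, the complement of such a disc, or an open or closed half-plane. $T$ is a Grace operator if there is a finite set $A\subset\mathbb C$ such that $Z(Tf)\subset Z(f)+\Omega$ for all $f\in\mathcal P_n\setminus\{0\}$ and all circular domains $\Omega\supset A$. **Theorem.** Let $T\in\mathcal L(\mathcal P_n)$, $T\neq0$. The following statements are equivalent. (a) $T\in\mathcal D(\mathcal P_n)$ and $T$ is invertible. (b) $T$ is a Grace operator. (c) $K_h(T)<+\infty$. (d) $K_m(T)<+\infty$. (e) $T$ is invertible and $TD=DT$. (f) $K_H(T)<+\infty$. (g) $\deg(Tf)=\deg(f)$ for all $f\in\mathcal P_n$ and $K_F(T)<+\infty$. -/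

import Mathlib

open scoped ENNReal Pointwise

namespace RootDistance

open Polynomial Set

/-- `P n`: the complex vector space of all polynomials of degree at most `n`. -/
noncomputable abbrev P (n : ℕ) : Submodule ℂ ℂ[X] := degreeLE ℂ (n : WithBot ℕ)

/-- Linear operators from `P n` to `P n`. -/
abbrev Op (n : ℕ) : Type := Module.End ℂ (P n)

theorem derivative_mem (n : ℕ) (f : ℂ[X]) (hf : f ∈ P n) :
    (derivative : ℂ[X] →ₗ[ℂ] ℂ[X]) f ∈ P n :=
  mem_degreeLE.2 ((degree_derivative_le).trans (mem_degreeLE.1 hf))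

/-- The operator of differentiation on `P n`. -/
noncomputable def D (n : ℕ) : Op n :=
  (derivative : ℂ[X] →ₗ[ℂ] ℂ[X]).restrict (derivative_mem n)

/-- The linear span of `I, D, ..., D ^ n` in the space of operators on `P n`. -/
noncomputable def DAlg (n : ℕ) : Submodule ℂ (Op n) :=
  Submodule.span ℂ {S : Op n | ∃ k : ℕ, k ≤ n ∧ S = D n ^ k}

/-- The set of complex roots of a polynomial; it is all of `ℂ` for the zero polynomial and empty
for a non-zero constant. -/
def Z (f : ℂ[X]) : Set ℂ := {z : ℂ | f.eval z = 0}

/-- Circular domains in the plane: open or closed discs, complements of closed or open discs,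
open or closed half-planes. -/
def IsCircularDomain (Ω : Set ℂ) : Prop :=
  (∃ (w : ℂ) (r : ℝ), 0 < r ∧
    (Ω = Metric.ball w r ∨ Ω = Metric.closedBall w r ∨
      Ω = (Metric.closedBall w r)ᶜ ∨ Ω = (Metric.ball w r)ᶜ)) ∨
  (∃ (a : ℂ) (c : ℝ), a ≠ 0 ∧ (Ω = {z : ℂ | c < (a * z).re} ∨ Ω = {z : ℂ | c ≤ (a * z).re}))

/-- Grace operators. -/
def IsGrace {n : ℕ} (T : Op n) : Prop :=
  ∃ A : Set ℂ, A.Finite ∧ ∀ f : P n, f ≠ 0 → ∀ Ω : Set ℂ, IsCircularDomain Ω → A ⊆ Ω →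
    Z (T f : ℂ[X]) ⊆ Z (f : ℂ[X]) + Ω

open Classical in
/-- The distance between two closest points, `min {|x - y| : x ∈ A, y ∈ B}`, with
`d(∅, ∅) = 0` and the value `∞` (an infimum over nothing) if exactly one of the sets is empty.
The value is `0` if one set is `ℂ` and the other one is not empty. -/
noncomputable def dm (A B : Set ℂ) : ℝ≥0∞ :=
  if A = ∅ ∧ B = ∅ then 0 else ⨅ x ∈ A, ⨅ y ∈ B, edist x y

open Classical in
/-- The asymmetric Hausdorff distance `max {dm A {y} : y ∈ B}`, with the conventions
`d(∅, ∅) = 0`, `d(A, ∅) = d(∅, A) = ∞` for `A ≠ ∅`, and, between non-empty sets, the value `0`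
if one of them is the whole plane. -/
noncomputable def dh (A B : Set ℂ) : ℝ≥0∞ :=
  if A = ∅ ∧ B = ∅ then 0
  else if A = ∅ ∨ B = ∅ then ∞
  else if A = univ ∨ B = univ then 0
  else ⨆ y ∈ B, dm A {y}

/-- The Hausdorff distance. -/
noncomputable def dH (A B : Set ℂ) : ℝ≥0∞ := max (dh A B) (dh B A)

/-- The Fréchet (matching) distance of two `m`-tuples:
the minimum over permutations `σ` of the maximum over `k` of `|u k - v (σ k)|`. -/
noncomputable def dFTuple {m : ℕ} (u v : Fin m → ℂ) : ℝ≥0∞ :=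
  ⨅ σ : Equiv.Perm (Fin m), ⨆ k : Fin m, edist (u k) (v (σ k))

/-- `u` lists the elements of the multiset `U`, with multiplicities. -/
def Enumerates {m : ℕ} (u : Fin m → ℂ) (U : Multiset ℂ) : Prop :=
  Multiset.map u Finset.univ.val = U

/-- The Fréchet (matching) distance of two multisets of the same size: the common value of
`dFTuple u v` over all enumerations `u` of `U` and `v` of `V`, see `dF_eq_dFTuple`. (Multisets of
different sizes have no enumerations of the same length; the value is then `∞`.) -/
noncomputable def dF (U V : Multiset ℂ) : ℝ≥0∞ :=
  ⨅ (m : ℕ) (u : Fin m → ℂ) (v : Fin m → ℂ) (_ : Enumerates u U) (_ : Enumerates v V),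
    dFTuple u v

theorem dFTuple_comp {m : ℕ} (u v : Fin m → ℂ) (s t : Equiv.Perm (Fin m)) :
    dFTuple (u ∘ s) (v ∘ t) = dFTuple u v := by
  unfold dFTuple
  have e : ∀ σ : Equiv.Perm (Fin m), (⨆ k, edist ((u ∘ s) k) ((v ∘ t) (σ k)))
      = ⨆ k, edist (u k) (v ((t * σ * s⁻¹) k)) := fun σ =>
    Equiv.iSup_congr s (fun k => by simp)
  simp_rw [e]
  exact Equiv.iInf_congr ((Equiv.mulLeft t).trans (Equiv.mulRight s⁻¹)) (fun σ => rfl)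

theorem exists_perm_of_enumerates {m : ℕ} {u v : Fin m → ℂ} {U : Multiset ℂ}
    (hu : Enumerates u U) (hv : Enumerates v U) : ∃ s : Equiv.Perm (Fin m), u = v ∘ s := by
  classical
  have key : ∀ c : ℂ, Nonempty ({k // u k = c} ≃ {k // v k = c}) := by
    intro c
    refine ⟨Fintype.equivOfCardEq ?_⟩
    have h := congrArg (Multiset.count c) (hu.trans hv.symm)
    rw [Multiset.count_map, Multiset.count_map] at h
    rw [Fintype.card_subtype, Fintype.card_subtype]
    simpa [eq_comm, Finset.card_def, Finset.filter_val] using h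
  refine ⟨(Equiv.sigmaFiberEquiv u).symm.trans ((Equiv.sigmaCongrRight fun c =>
    (key c).some).trans (Equiv.sigmaFiberEquiv v)), ?_⟩
  funext k
  exact ((key (u k)).some ⟨k, rfl⟩).2.symm

/-- The matching distance of multisets may be computed from any enumerations. -/
theorem dF_eq_dFTuple {m : ℕ} {u v : Fin m → ℂ} {U V : Multiset ℂ}
    (hu : Enumerates u U) (hv : Enumerates v V) : dF U V = dFTuple u v := by
  apply le_antisymm
  · exact iInf_le_of_le m <| iInf_le_of_le u <| iInf_le_of_le v <| iInf_le_of_le hu <|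
      iInf_le_of_le hv le_rfl
  · refine le_iInf fun m' => le_iInf fun u' => le_iInf fun v' => le_iInf fun hu' =>
      le_iInf fun hv' => ?_
    have hm : m' = m := by
      have h1 := congrArg Multiset.card hu
      have h2 := congrArg Multiset.card hu'
      simp at h1 h2
      omega
    subst hm
    obtain ⟨s, hs⟩ := exists_perm_of_enumerates hu' hu
    obtain ⟨t, ht⟩ := exists_perm_of_enumerates hv' hv
    rw [hs, ht, dFTuple_comp]

/-- Supremum of the closest-point distances between the roots of `f` and of `T f`. -/
noncomputable def Km {n : ℕ} (T : Op n) : ℝ≥0∞ :=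
  ⨆ f : P n, dm (Z (f : ℂ[X])) (Z (T f : ℂ[X]))

/-- Supremum of the asymmetric Hausdorff distances between the roots of `f` and of `T f`. -/
noncomputable def Kh {n : ℕ} (T : Op n) : ℝ≥0∞ :=
  ⨆ f : P n, dh (Z (f : ℂ[X])) (Z (T f : ℂ[X]))

/-- Supremum of the Hausdorff distances between the roots of `f` and of `T f`. -/
noncomputable def KH {n : ℕ} (T : Op n) : ℝ≥0∞ :=
  ⨆ f : P n, dH (Z (f : ℂ[X])) (Z (T f : ℂ[X]))

/-- `deg (T f) = deg f` for every `f`. -/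
def PreservesDegree {n : ℕ} (T : Op n) : Prop :=
  ∀ f : P n, (T f : ℂ[X]).degree = (f : ℂ[X]).degree

/-- Supremum, over non-constant `f`, of the matching distances between the root multisets of
`f` and `T f`; meaningful for operators that preserve the degree. -/
noncomputable def KF {n : ℕ} (T : Op n) : ℝ≥0∞ :=
  ⨆ (f : P n) (_ : 0 < (f : ℂ[X]).degree), dF (f : ℂ[X]).roots (T f : ℂ[X]).roots

end RootDistance

/-! The core of (a) ⇒ (b) is the Grace–Walsh–Szegő theorem, stated for linear functionals: if `L ((X
- u) ^ m)` vanishes for no `u` in a circular region, then `L` does not vanish on a product of `m`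
factors `X - z` with all `z` in that region (`apply_prod_ne_zero`, with an extra condition that
controls the behaviour at infinity). It follows by replacing one factor at a time, each replacement
being Laguerre's theorem `polar_ne_zero`. For `T = ∑ s j • D ^ j` with `s 0 ≠ 0`, take `L f = (T
f)(x)`. Since `T` commutes with translations, `L ((X - u) ^ m) = (T X ^ m)(x - u)`, so the finitely
many zeros of `T X ^ m`, `m ≤ n`, control all zeros of all `T f` (`Z_dop_subset`).

A large disc as circular domain gives finite `Kh`, hence finite `Km`. Conversely, if `Km` is finite,
test `T` on `(X - a) ^ k` for all `a`. The only root there is `a`, so `T ((X - a) ^ k)` has a root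
near `a`. This forces the discrepancy between `T` and a differential operator on `X ^ k` to be
bounded near every `a`, thus constant, and a constant is absorbed by a multiple of `D ^ k`
(`mem_DAlg_of_Km_lt_top`).

Finite `KH` comes from applying the same bound to `T⁻¹`. For `KF`, deform `T` to a multiple of the
identity through `∑ s j • (t D) ^ j`. The zeros stay in fixed discs around the zeros of `f`, so each
cluster of discs keeps its number of zeros, which yields a matching (`exists_perm_of_family`). -/

namespace RootDistance

open Polynomial Filter Topology

/-! ### Real quadratics describing circular regions, and means of points -/

/-- The real quadratic polynomial `a |y|² + Re (b y) + c` on the plane. -/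
noncomputable def circ (a : ℝ) (b : ℂ) (c : ℝ) (y : ℂ) : ℝ :=
  a * Complex.normSq y + (b * y).re + c

/-- A concave quadratic lies below its tangent plane at `w`, because `a * |x - w|² ≤ 0`; sum this
over the points of `s`. -/
theorem sum_circ_le (a : ℝ) (b : ℂ) (c : ℝ) (ha : a ≤ 0) (w : ℂ) (s : Multiset ℂ) :
    (s.map (circ a b c)).sum ≤
      a * (2 * (star w * s.sum).re - s.card * Complex.normSq w) + (b * s.sum).re + s.card * c := by
  induction s using Multiset.induction_on with
  | empty => simp
  | cons x s ih =>
    have h := mul_nonneg (neg_nonneg.2 ha) (Complex.normSq_nonneg (x - w))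
    simp only [Multiset.map_cons, Multiset.sum_cons, Multiset.card_cons, Nat.cast_succ]
    have e : circ a b c x ≤
        a * (2 * (star w * x).re - Complex.normSq w) + (b * x).re + c := by
      simp only [circ, Complex.normSq_apply, Complex.sub_re, Complex.sub_im, Complex.mul_re,
        Complex.star_def, Complex.conj_re, Complex.conj_im] at h ⊢
      nlinarith
    rw [mul_add, mul_add, Complex.add_re, Complex.add_re]
    linarith

/-- A concave `circ` that is positive on a multiset of at most `m` points is positive at their
sum divided by `m` (the missing points count as `0`). -/
theorem circ_pos_of_mul_eq_sum {a : ℝ} {b : ℂ} {c : ℝ} (ha : a ≤ 0) {s : Multiset ℂ} (hs : s ≠ 0)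
    {m : ℕ} (hm : s.card ≤ m) (hc : 0 ≤ c ∨ s.card = m) (pos : ∀ y ∈ s, 0 < circ a b c y)
    {w : ℂ} (hw : m * w = s.sum) : 0 < circ a b c w := by
  have h1 : 0 < (s.map (circ a b c)).sum := by
    obtain ⟨y, hy⟩ := Multiset.exists_mem_of_ne_zero hs
    obtain ⟨t, rfl⟩ := Multiset.exists_cons_of_mem hy
    rw [Multiset.map_cons, Multiset.sum_cons]
    refine add_pos_of_pos_of_nonneg (pos y hy) (Multiset.sum_nonneg fun x hx => ?_)
    obtain ⟨y', hy', rfl⟩ := Multiset.mem_map.1 hx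
    exact (pos y' (Multiset.mem_cons_of_mem hy')).le
  have h2 := sum_circ_le a b c ha w s
  have hm' : (s.card : ℝ) ≤ m := by exact_mod_cast hm
  have h3 : (s.card : ℝ) * c ≤ m * c := by
    rcases hc with hc | hc
    · exact mul_le_mul_of_nonneg_right hm' hc
    · rw [hc]
  have e1 : (star w * s.sum).re = m * Complex.normSq w := by
    rw [← hw]; simp [Complex.normSq_apply]; ring
  have e2 : (b * s.sum).re = m * (b * w).re := by
    rw [← hw]; simp; ring
  rw [e1, e2] at h2
  have h4 : a * (2 * (m * Complex.normSq w) - s.card * Complex.normSq w)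
      ≤ m * (a * Complex.normSq w) := by
    have := mul_nonneg (mul_nonneg (neg_nonneg.2 ha) (Complex.normSq_nonneg w))
      (sub_nonneg.2 hm')
    nlinarith
  have h5 : 0 < (m : ℝ) * circ a b c w := by
    unfold circ
    linarith
  exact pos_of_mul_pos_right h5 (Nat.cast_nonneg m)

/-- The inversion `w ↦ u - w⁻¹` turns `circ` into another `circ`. -/
theorem circ_inversion (a : ℝ) (b : ℂ) (c : ℝ) (u y : ℂ) (h : u ≠ y) :
    circ (circ a b c u) (-(2 * a * u) - star b) a (1 / (u - y)) =
      Complex.normSq (1 / (u - y)) * circ a b c y := by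
  have hd : u - y ≠ 0 := sub_ne_zero.2 h
  obtain ⟨w, hw⟩ : ∃ w, w = 1 / (u - y) := ⟨_, rfl⟩
  obtain ⟨v, hv⟩ : ∃ v, v = u - y := ⟨_, rfl⟩
  have hy : y = u - v := by rw [hv]; ring
  rw [← hv] at hd hw ⊢
  subst hy
  have hn : Complex.normSq v ≠ 0 := by simpa using hd
  rw [one_div]
  simp only [circ, Complex.normSq_inv, Complex.inv_re, Complex.inv_im, Complex.mul_re,
    Complex.star_def, Complex.conj_re, Complex.conj_im, Complex.sub_re, Complex.sub_im,
    Complex.neg_re, Complex.neg_im, Complex.mul_im, Complex.ofReal_re, Complex.ofReal_im,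
    Complex.re_ofNat, Complex.im_ofNat]
  field_simp
  simp only [Complex.normSq_apply, Complex.sub_re, Complex.sub_im]
  ring

/-! ### Laguerre's theorem and the Grace–Walsh–Szegő theorem for linear functionals -/

/-- The polynomial `u ↦ L ((X - u) ^ m)`. -/
noncomputable def binomPoly (L : ℂ[X] →ₗ[ℂ] ℂ) (m : ℕ) : ℂ[X] :=
  ∑ i ∈ Finset.range (m + 1), C (L (X ^ (m - i)) * (-1) ^ i * m.choose i) * X ^ i

theorem coeff_binomPoly (L : ℂ[X] →ₗ[ℂ] ℂ) (m i : ℕ) :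
    (binomPoly L m).coeff i = L (X ^ (m - i)) * (-1) ^ i * m.choose i := by
  simp only [binomPoly, finsetSum_coeff, coeff_C_mul, coeff_X_pow, mul_ite, mul_one, mul_zero]
  rw [Finset.sum_ite_eq]
  split_ifs with h
  · rfl
  · rw [Nat.choose_eq_zero_of_lt (by simpa using h)]; simp

theorem eval_binomPoly (L : ℂ[X] →ₗ[ℂ] ℂ) (m : ℕ) (u : ℂ) :
    (binomPoly L m).eval u = L ((X - C u) ^ m) := by
  rw [sub_eq_neg_add, add_pow, map_sum, binomPoly, eval_finsetSum]
  refine Finset.sum_congr rfl fun i _ => ?_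
  have : (-C u) ^ i * X ^ (m - i) * (m.choose i : ℂ[X]) =
      ((-u) ^ i * m.choose i) • X ^ (m - i) := by
    rw [smul_eq_C_mul]; simp; ring
  rw [this, map_smul]
  simp [neg_pow u]
  ring

theorem derivative_binomPoly (L : ℂ[X] →ₗ[ℂ] ℂ) (k : ℕ) :
    derivative (binomPoly L (k + 1)) = C (-((k : ℂ) + 1)) * binomPoly L k := by
  ext i
  rw [coeff_derivative, coeff_C_mul, coeff_binomPoly, coeff_binomPoly, Nat.add_sub_add_right]
  have h : ((k : ℂ) + 1) * k.choose i = (k + 1).choose (i + 1) * (i + 1) := by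
    exact_mod_cast Nat.add_one_mul_choose_eq k i
  rw [pow_succ]
  linear_combination (-(L (X ^ (k - i))) * (-1) ^ i) * (-h)

theorem natDegree_binomPoly_le (L : ℂ[X] →ₗ[ℂ] ℂ) (m : ℕ) : (binomPoly L m).natDegree ≤ m := by
  rw [natDegree_le_iff_coeff_eq_zero]
  intro i hi
  rw [coeff_binomPoly, Nat.choose_eq_zero_of_lt hi]; simp

theorem natDegree_binomPoly (L : ℂ[X] →ₗ[ℂ] ℂ) (m : ℕ) (h : L 1 ≠ 0) :
    (binomPoly L m).natDegree = m := by
  refine natDegree_eq_of_le_of_coeff_ne_zero (natDegree_binomPoly_le L m) ?_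
  rw [coeff_binomPoly]; simpa using h

theorem sum_roots_binomPoly (L : ℂ[X] →ₗ[ℂ] ℂ) (k : ℕ) (h : L 1 ≠ 0) :
    L 1 * (binomPoly L (k + 1)).roots.sum = (k + 1) * L X := by
  have h1 := (IsAlgClosed.splits (binomPoly L (k + 1))).nextCoeff_eq_neg_sum_roots_mul_leadingCoeff
  rw [nextCoeff_of_natDegree_pos (by rw [natDegree_binomPoly L _ h]; omega), leadingCoeff,
    natDegree_binomPoly L _ h, coeff_binomPoly, coeff_binomPoly] at h1
  simp [pow_succ] at h1
  have : ((-1 : ℂ)) ^ k ≠ 0 := by simp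
  apply mul_left_cancel₀ this
  linear_combination -h1

/-- Laguerre's theorem on polar derivatives, in terms of linear functionals. -/
theorem polar_ne_zero {a : ℝ} {b : ℂ} {c : ℝ} (L : ℂ[X] →ₗ[ℂ] ℂ) (hinf : 0 ≤ a ∨ L 1 ≠ 0) (k : ℕ)
    (hL : ∀ u, circ a b c u ≤ 0 → L ((X - C u) ^ (k + 1)) ≠ 0) {z u : ℂ}
    (hz : circ a b c z ≤ 0) (hu : circ a b c u ≤ 0) : L ((X - C z) * (X - C u) ^ k) ≠ 0 := by
  intro h0
  set q := binomPoly L (k + 1) with hq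
  have hqu : q.eval u ≠ 0 := by rw [hq, eval_binomPoly]; exact hL u hu
  have hne : u ≠ z := by
    rintro rfl
    exact hL u hu (by rw [pow_succ']; exact h0)
  have hsub : u - z ≠ 0 := sub_ne_zero.2 hne
  have hk : (k : ℂ) + 1 ≠ 0 := by exact_mod_cast Nat.succ_ne_zero k
  have hsplit : (X - C z) * (X - C u) ^ k =
      (X - C u) ^ (k + 1) + (u - z) • (X - C u) ^ k := by
    rw [smul_eq_C_mul, C_sub]; ring
  rw [hsplit, map_add, map_smul, smul_eq_mul] at h0
  have hder : (derivative q).eval u = -((k : ℂ) + 1) * L ((X - C u) ^ k) := by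
    rw [hq, derivative_binomPoly, eval_mul, eval_C, eval_binomPoly]
  -- The logarithmic derivative is also `∑ 1 / (u - y)` over the roots `y` of `q`. Hence `1 / (u -
  -- z)` is the mean of the inverted roots, a root lost to a degree drop counting as `0`.
  have hquot : (derivative q).eval u / q.eval u = (k + 1) * (1 / (u - z)) := by
    rw [hder, hq, eval_binomPoly]
    rw [hq, eval_binomPoly] at hqu
    field_simp
    linear_combination -h0
  rw [(IsAlgClosed.splits q).eval_derivative_div_eval_of_ne_zero hqu] at hquot
  have hq0 : q ≠ 0 := by rintro h; rw [h] at hqu; simp at hqu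
  have hroot : ∀ y ∈ q.roots, 0 < circ a b c y ∧ u ≠ y := by
    intro y hy
    have hy' : q.eval y = 0 := (mem_roots hq0).1 hy
    refine ⟨?_, by rintro rfl; exact hqu hy'⟩
    by_contra hcon
    rw [hq, eval_binomPoly] at hy'
    exact hL y (not_lt.1 hcon) hy'
  have hcard : q.roots.card = q.natDegree :=
    ((IsAlgClosed.splits q).natDegree_eq_card_roots).symm
  -- Inversion at `u` gives a quadratic with leading coefficient `circ a b c u ≤ 0`, so its
  -- positivity region is convex and contains the mean.
  have key := circ_pos_of_mul_eq_sum (a := circ a b c u) (b := -(2 * a * u) - star b)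
    (c := a) hu (s := q.roots.map fun y => 1 / (u - y)) (m := k + 1) (w := 1 / (u - z)) ?_ ?_ ?_ ?_ ?_
  · rw [circ_inversion _ _ _ _ _ hne] at key
    exact absurd (pos_of_mul_pos_right key (Complex.normSq_nonneg _)) (not_lt.2 hz)
  · intro h
    rw [h] at hquot
    simp [hk, hsub] at hquot
  · rw [Multiset.card_map, hcard]; exact natDegree_binomPoly_le L _
  -- The constant term `a` is the value at the image `0` of infinity. It must be nonnegative unless
  -- `L 1 ≠ 0`, in which case no root has escaped to infinity.
  · refine hinf.imp_right fun h => ?_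
    rw [Multiset.card_map, hcard]; exact natDegree_binomPoly L _ h
  · intro w hw
    obtain ⟨y, hy, rfl⟩ := Multiset.mem_map.1 hw
    rw [circ_inversion _ _ _ _ _ (hroot y hy).2]
    refine mul_pos (Complex.normSq_pos.2 ?_) (hroot y hy).1
    exact one_div_ne_zero (sub_ne_zero.2 (hroot y hy).2)
  · rw [hquot]; push_cast; ring

/-- If `L (X - C z) = 0`, then `z = L X / L 1` is the mean of the roots of `binomPoly L (k + 1)`.
These lie in a convex region that `z` avoids. This keeps the condition `L 1 ≠ 0` alive when a factor
is absorbed into the functional. -/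
theorem apply_X_sub_C_ne_zero {a : ℝ} {b : ℂ} {c : ℝ} (L : ℂ[X] →ₗ[ℂ] ℂ) (ha : a ≤ 0) (h1 : L 1 ≠ 0)
    (k : ℕ) (hL : ∀ u, circ a b c u ≤ 0 → L ((X - C u) ^ (k + 1)) ≠ 0) {z : ℂ}
    (hz : circ a b c z ≤ 0) : L (X - C z) ≠ 0 := by
  intro h0
  set q := binomPoly L (k + 1) with hq
  have hcard : q.roots.card = k + 1 := by
    rw [← natDegree_binomPoly L (k + 1) h1]
    exact ((IsAlgClosed.splits q).natDegree_eq_card_roots).symm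
  have hz1 : L X = z * L 1 := by
    have : (X - C z : ℂ[X]) = X - z • (1 : ℂ[X]) := by rw [smul_eq_C_mul, mul_one]
    rw [this, map_sub, map_smul, smul_eq_mul] at h0
    linear_combination h0
  have hsum := sum_roots_binomPoly L k h1
  rw [hz1] at hsum
  have key := circ_pos_of_mul_eq_sum (b := b) (c := c) ha (s := q.roots) (m := k + 1) (w := z)
    (fun h => by rw [h] at hcard; simp at hcard) hcard.le (Or.inr hcard) ?_ ?_
  · exact absurd key (not_lt.2 hz)
  · intro y hy
    have hy' : q.eval y = 0 := (mem_roots'.1 hy).2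
    by_contra hcon
    rw [hq, eval_binomPoly] at hy'
    exact hL y (not_lt.1 hcon) hy'
  · apply mul_left_cancel₀ h1
    rw [hsum]; push_cast; ring

/-- The Grace–Walsh–Szegő theorem, in terms of linear functionals, for closed circular domains. -/
theorem apply_prod_ne_zero {a : ℝ} {b : ℂ} {c : ℝ} {u₀ : ℂ} (hu₀ : circ a b c u₀ ≤ 0)
    (s : Multiset ℂ) : ∀ (L : ℂ[X] →ₗ[ℂ] ℂ), (0 ≤ a ∨ L 1 ≠ 0) →
    (∀ u, circ a b c u ≤ 0 → L ((X - C u) ^ s.card) ≠ 0) → (∀ z ∈ s, circ a b c z ≤ 0) →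
    L (s.map fun z => X - C z).prod ≠ 0 := by
  induction s using Multiset.induction_on with
  | empty => intro L _ hL _; simpa using hL u₀ hu₀
  | cons z s ih =>
    intro L hinf hL hs
    rw [Multiset.card_cons] at hL
    have hz := hs z (Multiset.mem_cons_self z s)
    rw [Multiset.map_cons, Multiset.prod_cons]
    -- The factor `X - C z` is absorbed into the functional, and Laguerre's theorem supplies the
    -- hypothesis for one factor fewer.
    refine ih (L ∘ₗ LinearMap.mulLeft ℂ (X - C z)) ?_ ?_ fun x hx => hs x (Multiset.mem_cons_of_mem hx)
    · by_cases ha : 0 ≤ a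
      · exact Or.inl ha
      · right
        simpa using apply_X_sub_C_ne_zero L (not_le.1 ha).le (hinf.resolve_left ha) _ hL hz
    · intro u hu
      simpa using polar_ne_zero L hinf _ hL hz hu

/-- Finitely many points of an open region lie in a smaller closed one: lower `c` by the largest
value of `circ` on `s`. -/
theorem apply_prod_ne_zero_of_neg {a : ℝ} {b : ℂ} {c : ℝ}
    {s : Multiset ℂ} (h0 : s ≠ 0) (L : ℂ[X] →ₗ[ℂ] ℂ) (h1 : L 1 ≠ 0)
    (hL : ∀ u, circ a b c u < 0 → L ((X - C u) ^ s.card) ≠ 0) (hs : ∀ z ∈ s, circ a b c z < 0) :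
    L (s.map fun z => X - C z).prod ≠ 0 := by
  obtain ⟨z₀, hz₀, hmax⟩ := s.toFinset.exists_max_image (circ a b c)
    (Multiset.toFinset_nonempty.2 h0)
  have hz := hs z₀ (Multiset.mem_toFinset.1 hz₀)
  have e : ∀ u, circ a b (c - circ a b c z₀) u = circ a b c u - circ a b c z₀ := fun u => by
    simp only [circ]; ring
  refine apply_prod_ne_zero (a := a) (b := b) (c := c - circ a b c z₀) (u₀ := z₀) ?_ s L (Or.inr h1)
    (fun u hu => hL u ?_) fun z hz' => ?_
  · rw [e]; simp
  · rw [e] at hu; linarith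
  · rw [e]; have := hmax z (Multiset.mem_toFinset.2 hz'); linarith

/-! ### Differential operators with constant coefficients -/

/-- The differential operator `∑ j ≤ n, s j • D ^ j` on all polynomials. -/
noncomputable def dop (n : ℕ) (s : ℕ → ℂ) : ℂ[X] →ₗ[ℂ] ℂ[X] :=
  ∑ j ∈ Finset.range (n + 1), s j • (derivative : ℂ[X] →ₗ[ℂ] ℂ[X]) ^ j

theorem dop_apply (n : ℕ) (s : ℕ → ℂ) (f : ℂ[X]) :
    dop n s f = ∑ j ∈ Finset.range (n + 1), s j • derivative^[j] f := by
  simp [dop, Module.End.pow_apply]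

theorem coe_D_pow {n : ℕ} (k : ℕ) (f : P n) : ((D n ^ k) f : ℂ[X]) = derivative^[k] (f : ℂ[X]) := by
  induction k with
  | zero => simp
  | succ k ih =>
    rw [pow_succ', Function.iterate_succ_apply', ← ih]
    rfl

theorem mem_DAlg_iff {n : ℕ} {T : Op n} :
    T ∈ DAlg n ↔ ∃ s : ℕ → ℂ, ∀ f : P n, (T f : ℂ[X]) = dop n s f := by
  constructor
  · intro h
    induction h using Submodule.span_induction with
    | mem S hS =>
      obtain ⟨k, hk, rfl⟩ := hS
      refine ⟨Pi.single k 1, fun f => ?_⟩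
      rw [coe_D_pow, dop_apply, Finset.sum_eq_single k]
      · simp
      · intro j _ hj; simp [hj]
      · intro h; simp at h; omega
    | zero => exact ⟨0, fun f => by simp [dop_apply]⟩
    | add S S' _ _ h h' =>
      obtain ⟨s, hs⟩ := h
      obtain ⟨s', hs'⟩ := h'
      refine ⟨s + s', fun f => ?_⟩
      simp [dop_apply, hs, hs', add_smul, Finset.sum_add_distrib]
    | smul c S _ h =>
      obtain ⟨s, hs⟩ := h
      refine ⟨c • s, fun f => ?_⟩
      simp [dop_apply, hs, Finset.smul_sum, smul_smul]
  · rintro ⟨s, hs⟩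
    have : T = ∑ j ∈ Finset.range (n + 1), s j • D n ^ j := by
      ext1 f
      apply Subtype.ext
      rw [hs, dop_apply]
      simp [LinearMap.sum_apply, coe_D_pow]
    rw [this]
    refine Submodule.sum_mem _ fun j hj => Submodule.smul_mem _ _ (Submodule.subset_span ⟨j, ?_, rfl⟩)
    simpa [Nat.lt_succ_iff] using hj

theorem iterate_derivative_comp_X_sub_C (f : ℂ[X]) (u : ℂ) (j : ℕ) :
    derivative^[j] (f.comp (X - C u)) = (derivative^[j] f).comp (X - C u) := by
  induction j with
  | zero => rfl
  | succ j ih => rw [Function.iterate_succ_apply', ih, Function.iterate_succ_apply']; simp [derivative_comp]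

theorem dop_comp (n : ℕ) (s : ℕ → ℂ) (f : ℂ[X]) (u : ℂ) :
    dop n s (f.comp (X - C u)) = (dop n s f).comp (X - C u) := by
  simp [dop_apply, iterate_derivative_comp_X_sub_C, sum_comp, smul_comp]

theorem dop_X_sub_C_pow (n : ℕ) (s : ℕ → ℂ) (m : ℕ) (u : ℂ) :
    dop n s ((X - C u) ^ m) = (dop n s (X ^ m)).comp (X - C u) := by
  rw [← dop_comp]; simp

theorem degree_dop (n : ℕ) (s : ℕ → ℂ) (hs : s 0 ≠ 0) (f : ℂ[X]) :
    (dop n s f).degree = f.degree := by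
  rcases eq_or_ne f 0 with rfl | hf
  · simp
  rw [dop_apply, Finset.sum_range_succ']
  have h0 : (s 0 • derivative^[0] f).degree = f.degree := by
    rw [smul_eq_C_mul, degree_C_mul hs]; rfl
  have hb : ⊥ < f.degree := bot_lt_iff_ne_bot.2 (fun h => hf (degree_eq_bot.1 h))
  rw [degree_add_eq_right_of_degree_lt, h0]
  rw [h0]
  refine lt_of_le_of_lt (degree_sum_le _ _) ((Finset.sup_lt_iff hb).2 fun j hj => ?_)
  clear hj
  refine lt_of_le_of_lt (degree_smul_le _ _) ?_
  rw [Function.iterate_succ_apply]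
  refine lt_of_le_of_lt ?_ (degree_derivative_lt hf)
  generalize derivative f = g
  induction j with
  | zero => exact le_rfl
  | succ j ih =>
    rw [Function.iterate_succ_apply']
    exact degree_derivative_le.trans ih

theorem leadingCoeff_dop (n : ℕ) (s : ℕ → ℂ) (hs : s 0 ≠ 0) (f : ℂ[X]) :
    (dop n s f).leadingCoeff = s 0 * f.leadingCoeff := by
  rw [leadingCoeff, natDegree_eq_of_degree_eq (degree_dop n s hs f), dop_apply,
    Finset.sum_range_succ', coeff_add, finsetSum_coeff, Finset.sum_eq_zero, zero_add]
  · simp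
  · intro j _
    rw [coeff_smul, coeff_iterate_derivative, coeff_eq_zero_of_natDegree_lt (by omega)]
    simp

theorem dop_one (n : ℕ) (s : ℕ → ℂ) : dop n s 1 = C (s 0) := by
  rw [dop_apply, Finset.sum_range_succ', Finset.sum_eq_zero]
  · simp [smul_eq_C_mul]
  · intro j _
    rw [Function.iterate_succ_apply]; simp

/-- The constant polynomial `1` in `P n`. -/
noncomputable def oneP (n : ℕ) : P n :=
  ⟨1, mem_degreeLE.2 (degree_one_le.trans (by exact_mod_cast Nat.zero_le n))⟩

instance instFiniteP (n : ℕ) : Module.Finite ℂ (P n) := by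
  classical
  rw [Module.Finite.iff_fg]
  exact ⟨_, degreeLE_eq_span_X_pow.symm⟩

theorem isUnit_of_ker {n : ℕ} {T : Op n} (h : ∀ f, T f = 0 → f = 0) : IsUnit T :=
  (LinearMap.isUnit_iff_ker_eq_bot T).2 (LinearMap.ker_eq_bot'.2 h)

theorem eq_zero_of_isUnit {n : ℕ} {T : Op n} (h : IsUnit T) {f : P n} (hf : T f = 0) : f = 0 :=
  LinearMap.ker_eq_bot'.1 ((LinearMap.isUnit_iff_ker_eq_bot T).1 h) f hf

theorem ne_zero_of_isUnit {n : ℕ} {T : Op n} {s : ℕ → ℂ} (hs : ∀ f : P n, (T f : ℂ[X]) = dop n s f)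
    (h : IsUnit T) : s 0 ≠ 0 := by
  intro h0
  have : oneP n = 0 := eq_zero_of_isUnit h (Subtype.ext (by
    rw [hs]; simp [oneP, dop_one, h0]))
  simpa [oneP] using congrArg Subtype.val this

theorem isUnit_of_ne_zero {n : ℕ} {T : Op n} {s : ℕ → ℂ} (hs : ∀ f : P n, (T f : ℂ[X]) = dop n s f)
    (h : s 0 ≠ 0) : IsUnit T := by
  refine isUnit_of_ker fun f hf => ?_
  have h1 := degree_dop n s h f
  rw [← hs, hf] at h1
  exact Subtype.ext (degree_eq_bot.1 (by simpa using h1.symm))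

theorem commute_D_of_mem_DAlg {n : ℕ} {T : Op n} (h : T ∈ DAlg n) : T * D n = D n * T := by
  induction h using Submodule.span_induction with
  | mem S hS => obtain ⟨k, -, rfl⟩ := hS; exact (pow_mul_comm' _ _)
  | zero => simp
  | add S S' _ _ h h' => rw [add_mul, mul_add, h, h']
  | smul c S _ h => rw [smul_mul_assoc, mul_smul_comm, h]

/-- The monomial `X ^ k` in `P n`, for `k ≤ n`. -/
noncomputable def mono (n k : ℕ) (h : k ≤ n) : P n :=
  ⟨X ^ k, mem_degreeLE.2 (by rw [degree_X_pow]; exact_mod_cast h)⟩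

theorem eq_sum_mono {n : ℕ} (f : P n) :
    f = ∑ j : Fin (n + 1), (f : ℂ[X]).coeff j • mono n j (Nat.lt_succ_iff.1 j.2) := by
  apply Subtype.ext
  rw [AddSubmonoidClass.coe_finsetSum]
  simp only [mono, SetLike.val_smul, smul_eq_C_mul]
  rw [Fin.sum_univ_eq_sum_range (fun j => C ((f : ℂ[X]).coeff j) * X ^ j) (n + 1)]
  refine as_sum_range_C_mul_X_pow' (f : ℂ[X]) ?_
  exact Nat.lt_succ_iff.2 (natDegree_le_of_degree_le (mem_degreeLE.1 f.2))

/-- An operator belongs to `DAlg n` as soon as it differs by a constant, on each monomial, from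
an operator in `DAlg n` that agrees with it on the monomials of lower degree. -/
theorem mem_DAlg_of_step {n : ℕ} (T : Op n)
    (h : ∀ (k : ℕ) (hk : k ≤ n) (s : ℕ → ℂ),
      (∀ (j : ℕ) (hj : j < k), (T (mono n j (hj.le.trans hk)) : ℂ[X]) = dop n s (X ^ j)) →
      ∃ r : ℂ, (T (mono n k hk) : ℂ[X]) = dop n s (X ^ k) + C r) : T ∈ DAlg n := by
  have main : ∀ k : ℕ, k ≤ n + 1 → ∃ s : ℕ → ℂ, ∀ (j : ℕ) (_ : j < k) (hn : j ≤ n),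
      (T (mono n j hn) : ℂ[X]) = dop n s (X ^ j) := by
    intro k
    induction k with
    | zero => exact fun _ => ⟨0, fun j hj => absurd hj (Nat.not_lt_zero j)⟩
    | succ k ih =>
      intro hk
      obtain ⟨s, hs⟩ := ih (by omega)
      obtain ⟨r, hr⟩ := h k (by omega) s fun j hj => hs j hj _
      -- The added multiple of the `k`-th derivative kills lower powers and sends `X ^ k` to the
      -- missing constant `r`.
      have hadd : ∀ f : ℂ[X], dop n (s + Pi.single k (r / k.factorial)) f =
          dop n s f + (r / k.factorial) • derivative^[k] f := by
        intro f
        simp only [dop_apply, Pi.add_apply, add_smul, Finset.sum_add_distrib]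
        congr 1
        rw [Finset.sum_eq_single k]
        · simp
        · intro j _ hj; simp [hj]
        · intro h; simp at h; omega
      refine ⟨s + Pi.single k (r / k.factorial), fun j hj hn => ?_⟩
      rw [hadd]
      rcases Nat.lt_succ_iff_lt_or_eq.1 hj with hj | rfl
      · rw [hs j hj hn, iterate_derivative_eq_zero (by simpa using hj), smul_zero, add_zero]
      · have hf : (j.factorial : ℂ) ≠ 0 := by exact_mod_cast j.factorial_ne_zero
        have hd : derivative^[j] (X ^ j : ℂ[X]) = C (j.factorial : ℂ) := by
          rw [iterate_derivative_X_pow_eq_smul]; simp [Nat.descFactorial_self, smul_eq_C_mul]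
        rw [hr, hd, smul_eq_C_mul, ← C_mul, div_mul_cancel₀ _ hf]
  obtain ⟨s, hs⟩ := main (n + 1) le_rfl
  refine mem_DAlg_iff.2 ⟨s, fun f => ?_⟩
  have hf := eq_sum_mono f
  have e : (f : ℂ[X]) = ∑ j : Fin (n + 1), (f : ℂ[X]).coeff j • X ^ (j : ℕ) := by
    conv_lhs => rw [hf]
    rw [AddSubmonoidClass.coe_finsetSum]
    rfl
  conv_rhs => rw [e]
  conv_lhs => rw [hf]
  simp only [map_sum, map_smul, AddSubmonoidClass.coe_finsetSum, SetLike.val_smul]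
  exact Finset.sum_congr rfl fun j _ => by rw [hs j j.2]

theorem coe_D_apply {n : ℕ} (f : P n) : (D n f : ℂ[X]) = derivative (f : ℂ[X]) := rfl

theorem D_mono_zero (n : ℕ) (h : 0 ≤ n) : D n (mono n 0 h) = 0 := by
  apply Subtype.ext
  rw [coe_D_apply]
  simp [mono]

theorem D_mono_succ (n k : ℕ) (h : k + 1 ≤ n) :
    D n (mono n (k + 1) h) = ((k : ℂ) + 1) • mono n k (Nat.le_of_succ_le h) := by
  apply Subtype.ext
  rw [coe_D_apply, SetLike.val_smul]
  simp [mono, smul_eq_C_mul]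

theorem derivative_dop (n : ℕ) (s : ℕ → ℂ) (f : ℂ[X]) :
    derivative (dop n s f) = dop n s (derivative f) := by
  rw [dop_apply, dop_apply, map_sum]
  refine Finset.sum_congr rfl fun j _ => ?_
  rw [derivative_smul, ← Function.iterate_succ_apply, Function.iterate_succ_apply']

/-- The discrepancy on `X ^ k` differentiates to `k` times the discrepancy on `X ^ (k - 1)`, which
vanishes, so it is constant. -/
theorem mem_DAlg_of_commute {n : ℕ} {T : Op n} (h : T * D n = D n * T) : T ∈ DAlg n := by
  refine mem_DAlg_of_step T fun k hk s hs => ?_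
  have hc : ∀ f : P n, (T (D n f) : ℂ[X]) = derivative (T f : ℂ[X]) := fun f => by
    rw [← coe_D_apply, ← Module.End.mul_apply, h, Module.End.mul_apply]
  have key : derivative ((T (mono n k hk) : ℂ[X]) - dop n s (X ^ k)) = 0 := by
    rw [derivative_sub, derivative_dop, ← hc, sub_eq_zero]
    cases k with
    | zero => rw [D_mono_zero]; simp
    | succ k =>
      rw [D_mono_succ, map_smul, SetLike.val_smul, hs k (by omega), ← map_smul,
        derivative_X_pow, smul_eq_C_mul]
      simp
  refine ⟨((T (mono n k hk) : ℂ[X]) - dop n s (X ^ k)).coeff 0, ?_⟩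
  rw [← eq_C_of_derivative_eq_zero key]
  ring

/-! ### Grace's theorem -/

theorem IsCircularDomain.exists_circ {Ω : Set ℂ} (h : IsCircularDomain Ω) :
    ∃ (a : ℝ) (b : ℂ) (c : ℝ), Ω = {y | 0 < circ a b c y} ∨ Ω = {y | 0 ≤ circ a b c y} := by
  have e : ∀ (w : ℂ) (r : ℝ) (y : ℂ),
      circ (-1) (2 * star w) (r ^ 2 - Complex.normSq w) y = r ^ 2 - ‖y - w‖ ^ 2 := by
    intro w r y
    rw [Complex.sq_norm]
    simp only [circ, Complex.normSq_apply, Complex.mul_re, Complex.mul_im, Complex.star_def,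
      Complex.conj_re, Complex.conj_im, Complex.sub_re, Complex.sub_im, Complex.re_ofNat,
      Complex.im_ofNat]
    ring
  have e' : ∀ (w : ℂ) (r : ℝ) (y : ℂ),
      circ 1 (-(2 * star w)) (Complex.normSq w - r ^ 2) y = ‖y - w‖ ^ 2 - r ^ 2 := by
    intro w r y
    rw [← neg_sub (r ^ 2), ← neg_sub (r ^ 2), ← e]
    simp only [circ, neg_mul, Complex.neg_re]
    ring
  rcases h with ⟨w, r, hr, h⟩ | ⟨a, c, -, h⟩
  · rcases h with rfl | rfl | rfl | rfl
    · refine ⟨-1, 2 * star w, r ^ 2 - Complex.normSq w, Or.inl (Set.ext fun y => ?_)⟩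
      rw [Set.mem_ofPred_eq, e w r, Metric.mem_ball, dist_eq_norm, sub_pos,
        sq_lt_sq₀ (norm_nonneg _) hr.le]
    · refine ⟨-1, 2 * star w, r ^ 2 - Complex.normSq w, Or.inr (Set.ext fun y => ?_)⟩
      rw [Set.mem_ofPred_eq, e w r, Metric.mem_closedBall, dist_eq_norm, sub_nonneg,
        sq_le_sq₀ (norm_nonneg _) hr.le]
    · refine ⟨1, -(2 * star w), Complex.normSq w - r ^ 2, Or.inl (Set.ext fun y => ?_)⟩
      rw [Set.mem_ofPred_eq, e' w r, Set.mem_compl_iff, Metric.mem_closedBall, dist_eq_norm, sub_pos,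
        sq_lt_sq₀ hr.le (norm_nonneg _), not_le]
    · refine ⟨1, -(2 * star w), Complex.normSq w - r ^ 2, Or.inr (Set.ext fun y => ?_)⟩
      rw [Set.mem_ofPred_eq, e' w r, Set.mem_compl_iff, Metric.mem_ball, dist_eq_norm, sub_nonneg,
        sq_le_sq₀ hr.le (norm_nonneg _), not_lt]
  · rcases h with rfl | rfl
    · exact ⟨0, a, -c, Or.inl (Set.ext fun y => by simp [circ])⟩
    · exact ⟨0, a, -c, Or.inr (Set.ext fun y => by simp [circ])⟩

/-- Circular regions are stable under `u ↦ x - u`, which turns conditions on `x - z` into conditions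
on the root `z`. -/
theorem circ_sub_left (a : ℝ) (b : ℂ) (c : ℝ) (x u : ℂ) :
    circ a b c (x - u) = circ a (-b - 2 * a * star x) (circ a b c x) u := by
  simp only [circ, Complex.normSq_apply, Complex.mul_re, Complex.mul_im, Complex.star_def,
      Complex.conj_re, Complex.conj_im, Complex.sub_re, Complex.sub_im, Complex.re_ofNat,
      Complex.im_ofNat, Complex.neg_re, Complex.neg_im, Complex.ofReal_re, Complex.ofReal_im]
  ring

/-- Grace's theorem for differential operators with constant coefficients. -/
theorem Z_dop_subset {n : ℕ} {s : ℕ → ℂ} (hs : s 0 ≠ 0) {f : ℂ[X]} (hf : f ≠ 0) {Ω : Set ℂ}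
    (hΩ : IsCircularDomain Ω) (h : Z (dop n s (X ^ f.natDegree)) ⊆ Ω) :
    Z (dop n s f) ⊆ Z f + Ω := by
  intro x hx
  by_contra hcon
  have hout : ∀ z ∈ f.roots, x - z ∉ Ω := fun z hz hzΩ =>
    hcon (Set.mem_add.2 ⟨z, ((mem_roots hf).1 hz :), x - z, hzΩ, by ring⟩)
  have hsplit := (IsAlgClosed.splits f).eq_prod_roots
  have hcard : f.roots.card = f.natDegree := (IsAlgClosed.splits f).natDegree_eq_card_roots.symm
  set L : ℂ[X] →ₗ[ℂ] ℂ := (leval x).comp (dop n s) with hLdef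
  have hL1 : L 1 ≠ 0 := by
    change (dop n s 1).eval x ≠ 0
    rw [dop_one]; simpa using hs
  have hLpow : ∀ u, x - u ∉ Ω → L ((X - C u) ^ f.roots.card) ≠ 0 := by
    intro u hu h0
    refine hu (h ?_)
    change (dop n s ((X - C u) ^ f.roots.card)).eval x = 0 at h0
    rw [hcard, dop_X_sub_C_pow, eval_comp] at h0
    simpa [Z] using h0
  have hLf : L (f.roots.map fun z => X - C z).prod = 0 := by
    have h0 : L f = 0 := hx
    rw [hsplit, ← smul_eq_C_mul, map_smul, smul_eq_mul] at h0
    exact (mul_eq_zero.1 h0).resolve_left (leadingCoeff_ne_zero.2 hf)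
  have hne : f.roots ≠ 0 := by
    intro h0
    rw [h0] at hLf
    exact hL1 (by simpa using hLf)
  obtain ⟨a, b, c, rfl | rfl⟩ := hΩ.exists_circ
  · simp only [Set.mem_ofPred_eq, circ_sub_left, not_lt] at hout hLpow
    obtain ⟨u₀, hu₀⟩ := Multiset.exists_mem_of_ne_zero hne
    exact apply_prod_ne_zero (hout u₀ hu₀) _ L (Or.inr hL1) hLpow hout hLf
  · simp only [Set.mem_ofPred_eq, circ_sub_left, not_le] at hout hLpow
    exact apply_prod_ne_zero_of_neg hne L hL1 hLpow hout hLf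

theorem Z_finite {f : ℂ[X]} (hf : f ≠ 0) : (Z f).Finite :=
  (f.rootSet_finite ℂ).subset fun z hz => (mem_rootSet_of_ne hf).2 (by simpa [Z] using hz)

theorem finite_iUnion_Z_dop {n : ℕ} {s : ℕ → ℂ} (hs : s 0 ≠ 0) :
    (⋃ m ∈ Finset.range (n + 1), Z (dop n s (X ^ m))).Finite := by
  refine Set.Finite.biUnion (Finset.finite_toSet _) fun m _ => Z_finite fun h => ?_
  have := degree_dop n s hs (X ^ m)
  rw [h, degree_X_pow] at this
  simp at this

theorem isGrace_of_mem_DAlg {n : ℕ} {T : Op n} (h : T ∈ DAlg n) (hT : IsUnit T) : IsGrace T := by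
  obtain ⟨s, hs⟩ := mem_DAlg_iff.1 h
  have h0 := ne_zero_of_isUnit hs hT
  refine ⟨⋃ m ∈ Finset.range (n + 1), Z (dop n s (X ^ m)), finite_iUnion_Z_dop h0,
    fun f hf Ω hΩ hA => ?_⟩
  rw [hs]
  refine Z_dop_subset h0 (fun h => hf (Subtype.ext h)) hΩ (subset_trans ?_ hA)
  refine Set.subset_biUnion_of_mem (u := fun m => Z (dop n s (X ^ m))) ?_
  simpa [Nat.lt_succ_iff] using natDegree_le_of_degree_le (mem_degreeLE.1 f.2)

/-! ### Root sets and the distances between them -/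

theorem Z_zero : Z 0 = Set.univ := by simp [Z]

theorem Z_eq_empty_iff {f : ℂ[X]} : Z f = ∅ ↔ f.degree = 0 := by
  constructor
  · intro h
    by_contra hd
    obtain ⟨z, hz⟩ := IsAlgClosed.exists_root f hd
    exact Set.notMem_empty z (h ▸ hz)
  · intro h
    rw [eq_C_of_degree_eq_zero h]
    have : f.coeff 0 ≠ 0 := by
      intro h0
      rw [eq_C_of_degree_eq_zero h, h0] at h
      simp at h
    simp [Z, this]

theorem dm_singleton (A : Set ℂ) (y : ℂ) : dm A {y} = ⨅ x ∈ A, edist x y := by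
  simp [dm]

theorem dm_le_dh (A B : Set ℂ) : dm A B ≤ dh A B := by
  unfold dh
  split_ifs with h1 h2 h3
  · simp [dm, h1]
  · exact le_top
  · push Not at h2
    obtain ⟨x, hx⟩ := h2.1
    obtain ⟨y, hy⟩ := h2.2
    rw [dm, if_neg h1]
    rcases h3 with rfl | rfl
    · exact iInf₂_le_of_le y trivial (iInf₂_le_of_le y hy (by simp))
    · exact iInf₂_le_of_le x hx (iInf₂_le_of_le x trivial (by simp))
  · push Not at h2
    obtain ⟨y, hy⟩ := h2.2
    refine le_trans ?_ (le_iSup₂_of_le y hy le_rfl)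
    rw [dm, if_neg h1, dm_singleton]
    exact le_iInf₂ fun x hx => iInf₂_le_of_le x hx (iInf₂_le_of_le y hy le_rfl)

theorem Km_le_Kh {n : ℕ} (T : Op n) : Km T ≤ Kh T := iSup_mono fun _ => dm_le_dh _ _

theorem dh_le_of_subset {A B : Set ℂ} {R : ℝ} (h : A = ∅ ↔ B = ∅)
    (hAB : B ⊆ A + Metric.closedBall 0 R) : dh A B ≤ ENNReal.ofReal R := by
  unfold dh
  split_ifs with h1 h2 h3
  · exact zero_le
  · tauto
  · exact zero_le
  · refine iSup₂_le fun y hy => ?_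
    obtain ⟨x, hx, w, hw, rfl⟩ := hAB hy
    rw [dm_singleton]
    refine iInf₂_le_of_le x hx ?_
    rw [edist_dist]
    refine ENNReal.ofReal_le_ofReal ?_
    simpa [dist_eq_norm] using hw

/-- A disc containing `A` bounds the distance between non-empty root sets. The rest rules out the
value `∞`, which needs `f` and `T f` to be non-zero constants simultaneously. -/
theorem Kh_lt_top_of_isGrace {n : ℕ} {T : Op n} (h : IsGrace T) : Kh T < ⊤ := by
  obtain ⟨A, hA, hG⟩ := h
  obtain ⟨R, hR0, hR⟩ := hA.isBounded.subset_closedBall_lt 0 0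
  have hsub : ∀ f : P n, f ≠ 0 → Z (T f : ℂ[X]) ⊆ Z (f : ℂ[X]) + Metric.closedBall 0 R :=
    fun f hf => hG f hf _ (Or.inl ⟨0, R, hR0, Or.inr (Or.inl rfl)⟩) hR
  have hne : ∀ f : P n, f ≠ 0 → (f : ℂ[X]) ≠ 0 := fun f hf h => hf (Subtype.ext h)
  have hinj : ∀ f : P n, f ≠ 0 → T f ≠ 0 := by
    intro f hf h0
    have h1 := hsub f hf
    rw [h0, ZeroMemClass.coe_zero, Z_zero] at h1
    have hb : Bornology.IsBounded (Z (f : ℂ[X]) + Metric.closedBall (0 : ℂ) R) :=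
      (Z_finite (hne f hf)).isBounded.add Metric.isBounded_closedBall
    exact NormedSpace.unbounded_univ ℂ ℂ (hb.subset h1)
  have hempty : ∀ f : P n, f ≠ 0 → Z (f : ℂ[X]) = ∅ → Z (T f : ℂ[X]) = ∅ := by
    intro f hf h0
    have h1 := hsub f hf
    rwa [h0, Set.empty_add, Set.subset_empty_iff] at h1
  have hone : (oneP n : P n) ≠ 0 := fun h => by
    simpa [oneP] using congrArg Subtype.val h
  have hT1 := Z_eq_empty_iff.1 (hempty (oneP n) hone (Z_eq_empty_iff.2 (by simp [oneP])))
  refine lt_of_le_of_lt (iSup_le fun f => ?_) (ENNReal.ofReal_lt_top (r := R))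
  rcases eq_or_ne f 0 with rfl | hf
  · rw [map_zero, ZeroMemClass.coe_zero, Z_zero]
    simp [dh, Set.univ_nonempty.ne_empty]
  refine dh_le_of_subset ⟨hempty f hf, fun h => ?_⟩ (hsub f hf)
  have hTf := Z_eq_empty_iff.1 h
  rw [eq_C_of_degree_eq_zero hT1] at hT1
  have hc : (T (oneP n) : ℂ[X]).coeff 0 ≠ 0 := by
    intro h0; rw [h0] at hT1; simp at hT1
  rw [eq_C_of_degree_eq_zero hTf] at hTf
  have hc' : (T f : ℂ[X]).coeff 0 ≠ 0 := by
    intro h0; rw [h0] at hTf; simp at hTf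
  -- Here `T f` and `T 1` are both non-zero constants, so injectivity makes `f` a multiple of `1`.
  set r := (T f : ℂ[X]).coeff 0 / (T (oneP n) : ℂ[X]).coeff 0 with hr
  have hzero : T (f - r • oneP n) = 0 := by
    apply Subtype.ext
    rw [map_sub, map_smul]
    simp only [Submodule.coe_sub, Submodule.coe_smul, ZeroMemClass.coe_zero]
    rw [eq_C_of_degree_eq_zero (Z_eq_empty_iff.1 h),
      eq_C_of_degree_eq_zero (p := (T (oneP n) : ℂ[X])) (Z_eq_empty_iff.1
        (hempty (oneP n) hone (Z_eq_empty_iff.2 (by simp [oneP])))),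
      smul_eq_C_mul, ← C_mul, hr, div_mul_cancel₀ _ hc, sub_self]
  have hf' : f = r • oneP n := sub_eq_zero.1 (by_contra fun hne => hinj _ hne hzero)
  rw [hf', Z_eq_empty_iff]
  have : r ≠ 0 := div_ne_zero hc' hc
  simp [oneP, smul_eq_C_mul, degree_C this]

/-- The reverse distance for `T` at `f` is the forward distance for the left inverse `S` at `T f`.
-/
theorem KH_lt_top {n : ℕ} {T S : Op n} (hTS : S * T = 1) (hT : Kh T < ⊤) (hS : Kh S < ⊤) :
    KH T < ⊤ := by
  refine lt_of_le_of_lt (iSup_le fun f => max_le_max ?_ ?_) (max_lt hT hS)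
  · exact le_iSup (fun f : P n => dh (Z (f : ℂ[X])) (Z (T f : ℂ[X]))) f
  · have h := le_iSup (fun f : P n => dh (Z (f : ℂ[X])) (Z (S f : ℂ[X]))) (T f)
    have e : S (T f) = f := by rw [← Module.End.mul_apply, hTS, Module.End.one_apply]
    rw [e] at h
    exact h

theorem Kh_le_KH {n : ℕ} (T : Op n) : Kh T ≤ KH T := iSup_mono fun _ => le_max_left _ _

/-! ### Finite `Km` forces a differential operator -/

theorem map_eq_zero_of_degree_lt {n k : ℕ} (hk : k ≤ n) (W : P n →ₗ[ℂ] ℂ[X])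
    (hW : ∀ (j : ℕ) (hj : j < k), W (mono n j (hj.le.trans hk)) = 0) (f : P n)
    (hf : (f : ℂ[X]).degree < k) : W f = 0 := by
  rw [eq_sum_mono f, map_sum]
  refine Finset.sum_eq_zero fun j _ => ?_
  rw [map_smul]
  by_cases hj : (j : ℕ) < k
  · rw [hW j hj, smul_zero]
  · rw [coeff_eq_zero_of_degree_lt (hf.trans_le (by exact_mod_cast not_lt.1 hj)), zero_smul]

theorem exists_root_near {n : ℕ} {T : Op n} (h : Km T < ⊤) :
    ∃ K : ℝ, ∀ f : P n, (Z (f : ℂ[X])).Nonempty →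
      ∃ x ∈ Z (f : ℂ[X]), ∃ y ∈ Z (T f : ℂ[X]), ‖y - x‖ ≤ K := by
  -- The `+ 1` makes the inequality strict, so that actual points realise it without attaining the
  -- infimum.
  refine ⟨(Km T + 1).toReal, fun f hf => ?_⟩
  have hne : Km T + 1 ≠ ⊤ := ENNReal.add_ne_top.2 ⟨h.ne, ENNReal.one_ne_top⟩
  have hlt : dm (Z (f : ℂ[X])) (Z (T f : ℂ[X])) < Km T + 1 :=
    (le_iSup (fun f : P n => dm (Z (f : ℂ[X])) (Z (T f : ℂ[X]))) f).trans_lt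
      (ENNReal.lt_add_right h.ne one_ne_zero)
  rw [dm, if_neg (fun h => hf.ne_empty h.1)] at hlt
  simp only [iInf_lt_iff] at hlt
  obtain ⟨x, hx, y, hy, hxy⟩ := hlt
  refine ⟨x, hx, y, hy, ?_⟩
  rw [edist_comm, edist_dist] at hxy
  rw [← dist_eq_norm]
  exact (ENNReal.ofReal_le_iff_le_toReal hne).1 hxy.le

theorem Z_map_eq_empty {n : ℕ} {T : Op n} (h : Km T < ⊤) {f : P n} (hf : Z (f : ℂ[X]) = ∅) :
    Z (T f : ℂ[X]) = ∅ := by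
  by_contra hne
  have hlt := (le_iSup (fun f : P n => dm (Z (f : ℂ[X])) (Z (T f : ℂ[X]))) f).trans_lt h
  rw [dm, if_neg (fun h => hne h.2), hf] at hlt
  simp at hlt

/-- A polynomial that is bounded at points of bounded distance to `0, 1, 2, …` is constant. -/
theorem degree_le_zero_of_bounded {R : ℂ[X]} {K M : ℝ}
    (h : ∀ a : ℂ, ∃ y, ‖y - a‖ ≤ K ∧ ‖R.eval y‖ ≤ M) : R.degree ≤ 0 := by
  by_contra hd
  choose y hy hM using fun N : ℕ => h N
  have h1 : Tendsto (fun N : ℕ => ‖y N‖) atTop atTop := by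
    refine tendsto_atTop_mono (fun N => ?_)
      (tendsto_atTop_add_const_right atTop (-K) tendsto_natCast_atTop_atTop)
    have := norm_sub_norm_le (N : ℂ) (y N)
    rw [norm_sub_rev, Complex.norm_natCast] at this
    linarith [hy N]
  obtain ⟨N, hN⟩ := ((R.tendsto_norm_atTop (not_le.1 hd) h1).eventually_gt_atTop M).exists
  exact absurd (hM N) (not_le.2 hN)

/-- As `(X - a) ^ k - X ^ k` has lower degree, `T ((X - a) ^ k)` is the translate by `a` of `dop n s
(X ^ k)`, plus `R` with no translation. At its root `y` near `a`, `R` is minus a value of a fixed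
polynomial on a fixed disc, hence bounded independently of `a`. -/
theorem mem_DAlg_of_Km_lt_top {n : ℕ} {T : Op n} (h : Km T < ⊤) : T ∈ DAlg n := by
  obtain ⟨K, hK⟩ := exists_root_near h
  refine mem_DAlg_of_step T fun k hk s hs => ?_
  set R : ℂ[X] := (T (mono n k hk) : ℂ[X]) - dop n s (X ^ k) with hR
  suffices hdeg : R.degree ≤ 0 by
    refine ⟨R.coeff 0, ?_⟩
    rw [← eq_C_of_degree_le_zero hdeg, hR]
    ring
  rcases Nat.eq_zero_or_pos k with rfl | hk0
  · have h1 : Z (T (mono n 0 hk) : ℂ[X]) = ∅ :=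
      Z_map_eq_empty h (Z_eq_empty_iff.2 (by simp [mono]))
    rw [hR, pow_zero, dop_one]
    exact (degree_sub_le _ _).trans (max_le (Z_eq_empty_iff.1 h1).le degree_C_le)
  set W : P n →ₗ[ℂ] ℂ[X] := (P n).subtype ∘ₗ T - dop n s ∘ₗ (P n).subtype with hW
  have hWa : ∀ f : P n, W f = (T f : ℂ[X]) - dop n s f := fun f => rfl
  obtain ⟨M, hM⟩ := (isCompact_closedBall (0 : ℂ) K).exists_bound_of_continuousOn
    (f := fun w => (dop n s (X ^ k)).eval w) (Polynomial.continuous _).continuousOn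
  refine degree_le_zero_of_bounded (K := K) (M := M) fun a => ?_
  have hd : ((X - C a) ^ k : ℂ[X]).degree = k := by rw [degree_pow, degree_X_sub_C]; simp
  obtain ⟨f, hf⟩ : ∃ f : P n, (f : ℂ[X]) = (X - C a) ^ k :=
    ⟨⟨(X - C a) ^ k, mem_degreeLE.2 (by rw [hd]; exact_mod_cast hk)⟩, rfl⟩
  have hTf : (T f : ℂ[X]) = (dop n s (X ^ k)).comp (X - C a) + R := by
    have h0 : W (f - mono n k hk) = 0 := by
      refine map_eq_zero_of_degree_lt hk W (fun j hj => ?_) _ ?_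
      · rw [hWa, hs j hj]; exact sub_self _
      · have e : ((f - mono n k hk : P n) : ℂ[X]) = (X - C a) ^ k - X ^ k := by
          rw [← hf]; rfl
        rw [e, ← hd]
        refine degree_sub_lt_left ?_ (pow_ne_zero _ (X_sub_C_ne_zero a)) ?_
        · rw [hd, degree_X_pow]
        · rw [((monic_X_sub_C a).pow k).leadingCoeff, (monic_X_pow k).leadingCoeff]
    have e : (mono n k hk : ℂ[X]) = X ^ k := rfl
    rw [map_sub, sub_eq_zero, hWa, hWa, hf, dop_X_sub_C_pow, e, ← hR] at h0
    rw [← h0]; ring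
  obtain ⟨x, hx, y, hy, hxy⟩ := hK f ⟨a, by simp [hf, Z, hk0.ne']⟩
  have hxa : x = a := by
    have : x - a = 0 := by simpa [hf, Z, hk0.ne'] using hx
    exact sub_eq_zero.1 this
  subst hxa
  refine ⟨y, hxy, ?_⟩
  have hy0 : (dop n s (X ^ k)).eval (y - x) + R.eval y = 0 := by
    have : (T f : ℂ[X]).eval y = 0 := hy
    rw [hTf, eval_add, eval_comp] at this
    simpa using this
  rw [eq_neg_of_add_eq_zero_right hy0, norm_neg]
  exact hM _ (by simpa using hxy)

/-- If `s 0 = 0`, then `T 1 = 0`: its root set is the plane while that of `1` is empty, at distance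
`∞`. -/
theorem isUnit_of_Km_lt_top {n : ℕ} {T : Op n} (h : Km T < ⊤) : IsUnit T := by
  obtain ⟨s, hs⟩ := mem_DAlg_iff.1 (mem_DAlg_of_Km_lt_top h)
  refine isUnit_of_ne_zero hs fun h0 => ?_
  have h1 : Z (T (oneP n) : ℂ[X]) = ∅ := Z_map_eq_empty h (Z_eq_empty_iff.2 (by simp [oneP]))
  rw [hs] at h1
  simp [oneP, dop_one, h0, Z_zero] at h1

theorem mem_DAlg_and_isUnit_iff {n : ℕ} {T : Op n} :
    (IsUnit T ∧ T * D n = D n * T) ↔ T ∈ DAlg n ∧ IsUnit T :=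
  ⟨fun h => ⟨mem_DAlg_of_commute h.2, h.1⟩, fun h => ⟨h.2, commute_D_of_mem_DAlg h.1⟩⟩

theorem KH_lt_top_of_mem_DAlg {n : ℕ} {T : Op n} (h : T ∈ DAlg n) (hT : IsUnit T) : KH T < ⊤ := by
  obtain ⟨u, rfl⟩ := hT
  have hc : Commute (u : Op n) (D n) := commute_D_of_mem_DAlg h
  exact KH_lt_top u.inv_mul (Kh_lt_top_of_isGrace (isGrace_of_mem_DAlg h u.isUnit))
    (Kh_lt_top_of_isGrace (isGrace_of_mem_DAlg (mem_DAlg_of_commute hc.units_inv_left) u⁻¹.isUnit))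

/-! ### The matching distance, and zeros along a homotopy -/

theorem dm_le_dF {f g : ℂ[X]} (hf : 0 < f.degree) (hg : g ≠ 0) :
    dm (Z f) (Z g) ≤ dF f.roots g.roots := by
  have hf0 : f ≠ 0 := by rintro rfl; simp at hf
  refine le_iInf fun m => le_iInf fun u => le_iInf fun v => le_iInf fun hu => le_iInf fun hv =>
    le_iInf fun σ => ?_
  have hm : 0 < m := by
    have h1 := congrArg Multiset.card hu
    rw [(IsAlgClosed.splits f).natDegree_eq_card_roots.symm] at h1
    have := natDegree_pos_iff_degree_pos.2 hf
    simp at h1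
    omega
  refine le_trans ?_ (le_iSup _ (⟨0, hm⟩ : Fin m))
  have hu0 : ∀ i, u i ∈ Z f := fun i =>
    (mem_roots hf0).1 (by rw [← hu]; exact Multiset.mem_map_of_mem _ (Finset.mem_univ_val _))
  have hv0 : ∀ i, v i ∈ Z g := fun i =>
    (mem_roots hg).1 (by rw [← hv]; exact Multiset.mem_map_of_mem _ (Finset.mem_univ_val _))
  rw [dm, if_neg (fun h => Set.notMem_empty _ (h.1 ▸ hu0 ⟨0, hm⟩))]
  exact iInf₂_le_of_le _ (hu0 _) (iInf₂_le _ (hv0 _))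

theorem Km_lt_top_of_KF {n : ℕ} {T : Op n} (hd : PreservesDegree T) (h : KF T < ⊤) :
    Km T < ⊤ := by
  refine lt_of_le_of_lt (iSup_le fun f => ?_) h
  by_cases hf : 0 < (f : ℂ[X]).degree
  · refine (dm_le_dF hf ?_).trans (le_iSup₂_of_le f hf le_rfl)
    intro h0
    rw [← hd f, h0] at hf
    simp at hf
  · rcases eq_or_ne f 0 with rfl | hf0
    · rw [map_zero, ZeroMemClass.coe_zero, Z_zero, dm, if_neg (by simp)]
      exact iInf₂_le_of_le 0 trivial (iInf₂_le_of_le 0 trivial (by simp))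
    · have h0 : (f : ℂ[X]).degree = 0 := le_antisymm (not_lt.1 hf)
        (zero_le_degree_iff.2 fun h => hf0 (Subtype.ext h))
      rw [Z_eq_empty_iff.2 h0, Z_eq_empty_iff.2 ((hd f).trans h0)]
      simp [dm]

theorem roots_prod_X_sub_C_fin {m : ℕ} (w : Fin m → ℂ) :
    (∏ i, (X - C (w i))).roots = Finset.univ.val.map w := by
  rw [← roots_multiset_prod_X_sub_C (Finset.univ.val.map w), Multiset.map_map]
  rfl

theorem exists_enumerates {U : Multiset ℂ} {m : ℕ} (h : U.card = m) :
    ∃ u : Fin m → ℂ, Enumerates u U := by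
  subst h
  induction U using Quotient.inductionOn with
  | h l => exact ⟨l.get, (Fin.univ_val_map l.get).trans (congrArg _ (List.ofFn_get l))⟩

/-- If the zeros of a continuous family of monic polynomials stay in the union of an open set `U`
and a disjoint open set, then the number of zeros in `U` stays constant. -/
theorem countP_roots_eq {m : ℕ} (p : ℝ → ℂ[X]) (hp : ∀ t, (p t).Monic)
    (hdeg : ∀ t, (p t).natDegree = m) (cont : ∀ x, Continuous fun t => (p t).eval x)
    {A B : Set ℂ} (hA : IsCompact A) (hB : IsCompact B) (hAB : Disjoint A B)
    [DecidablePred (· ∈ A)]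
    (hroots : ∀ t ∈ Set.Icc (0 : ℝ) 1, ∀ x, (p t).eval x = 0 → x ∈ A ∪ B) :
    (p 0).roots.countP (· ∈ A) = (p 1).roots.countP (· ∈ A) := by
  -- Pairs of a time and an enumeration of the roots at that time. No continuous choice of roots is
  -- needed: `S` is compact and projects onto `[0, 1]` by a quotient map, so continuity of the count
  -- is checked on `S`.
  let S : Set (ℝ × (Fin m → ℂ)) :=
    {q | q.1 ∈ Set.Icc (0 : ℝ) 1 ∧ ∀ x, ∏ i, (x - q.2 i) = (p q.1).eval x}
  have hpoly : ∀ q ∈ S, p q.1 = ∏ i, (X - C (q.2 i)) := fun q hq =>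
    Polynomial.funext fun x => by rw [← hq.2 x, eval_prod]; simp
  have hmem : ∀ q ∈ S, ∀ i, q.2 i ∈ A ∪ B := fun q hq i => hroots q.1 hq.1 _ (by
    rw [← hq.2, Finset.prod_eq_zero (Finset.mem_univ i) (sub_self _)])
  have hScl : IsClosed S := by
    have e : S = Prod.fst ⁻¹' Set.Icc (0 : ℝ) 1 ∩
        ⋂ x : ℂ, {q : ℝ × (Fin m → ℂ) | ∏ i, (x - q.2 i) = (p q.1).eval x} := by
      ext q; simp [S]
    rw [e]
    refine (isClosed_Icc.preimage continuous_fst).inter ?_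
    refine isClosed_iInter fun x => isClosed_eq ?_ ((cont x).comp continuous_fst)
    fun_prop
  have hScomp : IsCompact S := by
    refine IsCompact.of_isClosed_subset (isCompact_Icc.prod (isCompact_univ_pi fun _ : Fin m =>
      hA.union hB)) hScl fun q hq => ⟨hq.1, fun i _ => hmem q hq i⟩
  have : CompactSpace S := isCompact_iff_compactSpace.1 hScomp
  let π : S → Set.Icc (0 : ℝ) 1 := fun q => ⟨q.1.1, q.2.1⟩
  have hπ : Continuous π := by fun_prop
  have hsurj : Function.Surjective π := by
    rintro ⟨t, ht⟩
    obtain ⟨w, hw⟩ := exists_enumerates (U := (p t).roots) (m := m) (by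
      rw [← hdeg t]; exact (IsAlgClosed.splits (p t)).natDegree_eq_card_roots.symm)
    refine ⟨⟨(t, w), ht, fun x => ?_⟩, rfl⟩
    conv_rhs => rw [(IsAlgClosed.splits (p t)).eq_prod_roots_of_monic (hp t)]
    rw [eval_multiset_prod, Multiset.map_map, ← hw, Multiset.map_map]
    exact Finset.prod_congr rfl fun i _ => by simp
  have hquot : IsQuotientMap π := hπ.isClosedMap.isQuotientMap hπ hsurj
  let N : Set.Icc (0 : ℝ) 1 → ℕ := fun t => (p t).roots.countP (· ∈ A)
  have hN : Continuous N := by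
    rw [hquot.continuous_iff]
    have e : N ∘ π = fun q => ∑ i, if q.1.2 i ∈ A then 1 else 0 := by
      funext q
      change (p q.1.1).roots.countP (· ∈ A) = _
      rw [hpoly q.1 q.2, roots_prod_X_sub_C_fin, Multiset.countP_map, ← Finset.card_filter]
      rfl
    rw [e]
    refine continuous_finsetSum _ fun i _ => ?_
    have hcl : IsClosed {q : S | q.1.2 i ∈ A} := hA.isClosed.preimage (by fun_prop)
    have hop : IsOpen {q : S | q.1.2 i ∈ A} := by
      have : {q : S | q.1.2 i ∈ A} = {q : S | q.1.2 i ∈ B}ᶜ := by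
        ext q
        exact ⟨fun h h' => Set.disjoint_left.1 hAB h h', fun h =>
          (hmem q.1 q.2 i).resolve_right h⟩
      rw [this]
      exact (hB.isClosed.preimage (by fun_prop)).isOpen_compl
    refine Continuous.if (fun q hq => ?_) continuous_const continuous_const
    rw [IsClopen.frontier_eq ⟨hcl, hop⟩] at hq
    exact absurd hq (Set.notMem_empty q)
  have : PreconnectedSpace (Set.Icc (0 : ℝ) 1) :=
    isPreconnected_iff_preconnectedSpace.1 isPreconnected_Icc
  exact PreconnectedSpace.constant this hN (x := ⟨0, by simp⟩) (y := ⟨1, by simp⟩)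

/-- The graph joining the indices of points at distance at most `r`. -/
def nearGraph {m : ℕ} (z : Fin m → ℂ) (r : ℝ) : SimpleGraph (Fin m) where
  Adj i j := i ≠ j ∧ ‖z i - z j‖ ≤ r
  symm := ⟨fun i j h => ⟨h.1.symm, by rw [norm_sub_rev]; exact h.2⟩⟩
  loopless := ⟨fun i h => h.1 rfl⟩

theorem norm_sub_le_of_walk {m : ℕ} {z : Fin m → ℂ} {r : ℝ} {i j : Fin m}
    (w : (nearGraph z r).Walk i j) : ‖z i - z j‖ ≤ w.length * r := by
  induction w with
  | nil => simp
  | cons h w ih =>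
    rw [SimpleGraph.Walk.length_cons]
    push_cast
    have := norm_sub_le_norm_sub_add_norm_sub (z _) (z _) (z _) |>.trans (add_le_add h.2 ih)
    linarith

theorem norm_sub_le_of_reachable {m : ℕ} {z : Fin m → ℂ} {r : ℝ} (hr : 0 ≤ r) {i j : Fin m}
    (h : (nearGraph z r).Reachable i j) : ‖z i - z j‖ ≤ m * r := by
  classical
  obtain ⟨w⟩ := h
  -- A path visits each vertex at most once, so its length is below `m`.
  refine (norm_sub_le_of_walk w.bypass).trans (mul_le_mul_of_nonneg_right ?_ hr)
  have := w.bypass_isPath.length_lt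
  rw [Fintype.card_fin] at this
  exact_mod_cast this.le

/-- If the zeros of a continuous family of monic polynomials stay within distance `R` of the zeros
at time `0`, then the zeros at times `0` and `1` can be matched at a bounded distance. -/
theorem exists_perm_of_family {m : ℕ} (p : ℝ → ℂ[X]) (hp : ∀ t, (p t).Monic)
    (hdeg : ∀ t, (p t).natDegree = m) (cont : ∀ x, Continuous fun t => (p t).eval x)
    {z v : Fin m → ℂ} (hz : Enumerates z (p 0).roots) (hv : Enumerates v (p 1).roots) {R : ℝ}
    (hR : 0 < R)
    (hroots : ∀ t ∈ Set.Icc (0 : ℝ) 1, ∀ x, (p t).eval x = 0 → ∃ i, ‖x - z i‖ ≤ R) :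
    ∃ σ : Equiv.Perm (Fin m), ∀ i, ‖z i - v (σ i)‖ ≤ m * (2 * R) + R := by
  classical
  let G := nearGraph z (2 * R)
  -- Components are labelled by a representative index, cast to `ℂ` only so that
  -- `exists_perm_of_enumerates` applies to the labels.
  let comp : Fin m → ℂ := fun i => ((G.connectedComponentMk i).out : ℕ)
  have hcomp : ∀ i j, comp i = comp j ↔ G.Reachable i j := by
    intro i j
    rw [← SimpleGraph.ConnectedComponent.eq, Nat.cast_inj, Fin.val_inj]
    exact (Function.LeftInverse.injective Quot.out_eq).eq_iff
  have hnear : ∀ i j x, ‖x - z i‖ ≤ R → ‖x - z j‖ ≤ R → comp i = comp j := by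
    intro i j x hi hj
    rw [hcomp]
    rcases eq_or_ne i j with rfl | hij
    · exact SimpleGraph.Reachable.refl _
    · refine SimpleGraph.Adj.reachable ⟨hij, ?_⟩
      have := norm_sub_le_norm_sub_add_norm_sub (z i) x (z j)
      rw [norm_sub_rev (z i) x] at this
      linarith
  have hv1 : ∀ l, ∃ i, ‖v l - z i‖ ≤ R := fun l => hroots 1 (by simp) _ (by
    have : v l ∈ (p 1).roots := by rw [← hv]; exact Multiset.mem_map_of_mem _ (Finset.mem_univ_val _)
    exact (mem_roots'.1 this).2)
  choose j hj using hv1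
  have hcount : ∀ c : ℂ, Multiset.count c (Finset.univ.val.map comp) =
      Multiset.count c (Finset.univ.val.map (comp ∘ j)) := by
    intro c
    let near (q : Fin m → Prop) : Set ℂ := ⋃ i ∈ {i | q i}, Metric.closedBall (z i) R
    have hcpt : ∀ q, IsCompact (near q) := fun q =>
      (Set.toFinite _).isCompact_biUnion fun i _ => isCompact_closedBall _ _
    have hmem : ∀ q x, x ∈ near q ↔ ∃ i, q i ∧ ‖x - z i‖ ≤ R := fun q x => by
      simp [near, dist_eq_norm]
    have key := countP_roots_eq p hp hdeg cont (hcpt fun i => comp i = c)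
      (hcpt fun i => comp i ≠ c) ?_ ?_
    · rw [← hz, ← hv, Multiset.countP_map, Multiset.countP_map] at key
      rw [Multiset.count_map, Multiset.count_map]
      convert key using 3
      · rename_i i _
        rw [hmem]
        exact ⟨fun h => ⟨i, h.symm, by simpa using hR.le⟩, fun ⟨i', h, h'⟩ => by
          rw [← h]; exact (hnear i i' (z i) (by simpa using hR.le) h').symm⟩
      · rename_i l _
        rw [hmem]
        exact ⟨fun h => ⟨j l, h.symm, hj l⟩, fun ⟨i', h, h'⟩ => by
          rw [← h]; exact hnear _ _ _ h' (hj l)⟩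
    · rw [Set.disjoint_left]
      intro x hx hx'
      obtain ⟨i, hi, hxi⟩ := (hmem _ _).1 hx
      obtain ⟨i', hi', hxi'⟩ := (hmem _ _).1 hx'
      exact hi' ((hnear i' i x hxi' hxi).trans hi)
    · intro t ht x hx
      obtain ⟨i, hi⟩ := hroots t ht x hx
      by_cases hc : comp i = c
      · exact Or.inl ((hmem _ _).2 ⟨i, hc, hi⟩)
      · exact Or.inr ((hmem _ _).2 ⟨i, hc, hi⟩)
  obtain ⟨σ, hσ⟩ := exists_perm_of_enumerates (u := comp) (v := comp ∘ j)
    (U := Finset.univ.val.map comp) rfl (Multiset.ext.2 hcount).symm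
  refine ⟨σ, fun i => ?_⟩
  have h1 := norm_sub_le_of_reachable (by linarith) ((hcomp i (j (σ i))).1 (congrFun hσ i))
  have h2 := norm_sub_le_norm_sub_add_norm_sub (z i) (z (j (σ i))) (v (σ i))
  have h3 := hj (σ i)
  rw [norm_sub_rev] at h3
  linarith

/-- The coefficients of the operator obtained from `∑ s j • D ^ j` by replacing `D` by `t D`. -/
noncomputable def scaleCoeff (s : ℕ → ℂ) (t : ℝ) (j : ℕ) : ℂ := s j * (t : ℂ) ^ j

theorem eval_dop_X_pow (n : ℕ) (s : ℕ → ℂ) (m : ℕ) (x : ℂ) : (dop n s (X ^ m)).eval x =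
    ∑ j ∈ Finset.range (n + 1), s j * (m.descFactorial j * x ^ (m - j)) := by
  simp [dop_apply, eval_finsetSum, iterate_derivative_X_pow_eq_smul, smul_eq_C_mul]

/-- For `t ≠ 0` the zeros are those for `t = 1` multiplied by `t`; for `t = 0` only `0` can be a
zero. -/
theorem Z_dop_scaleCoeff_subset {n : ℕ} {s : ℕ → ℂ} (hs : s 0 ≠ 0) {m : ℕ} {R : ℝ} (hR : 0 ≤ R)
    (h : Z (dop n s (X ^ m)) ⊆ Metric.closedBall 0 R) {t : ℝ} (ht : t ∈ Set.Icc (0 : ℝ) 1) :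
    Z (dop n (scaleCoeff s t) (X ^ m)) ⊆ Metric.closedBall 0 R := by
  intro x hx
  have hx0 : (dop n (scaleCoeff s t) (X ^ m)).eval x = 0 := hx
  rw [eval_dop_X_pow] at hx0
  rcases eq_or_ne t 0 with rfl | ht0
  · rw [Finset.sum_range_succ', Finset.sum_eq_zero (fun j _ => by simp [scaleCoeff])] at hx0
    have : x = 0 := by
      have h1 : s 0 * x ^ m = 0 := by simpa [scaleCoeff] using hx0
      exact eq_zero_of_pow_eq_zero ((mul_eq_zero.1 h1).resolve_left hs)
    simpa [this] using hR
  · have htc : (t : ℂ) ≠ 0 := by exact_mod_cast ht0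
    have e : (t : ℂ) ^ m * (dop n s (X ^ m)).eval (x / t) = 0 := by
      rw [← hx0, eval_dop_X_pow, Finset.mul_sum]
      refine Finset.sum_congr rfl fun j _ => ?_
      by_cases hj : j ≤ m
      · obtain ⟨i, rfl⟩ := Nat.exists_eq_add_of_le hj
        rw [Nat.add_sub_cancel_left, div_pow, pow_add, scaleCoeff]
        field_simp
      · rw [Nat.descFactorial_of_lt (not_le.1 hj)]; simp
    have hy := h ((mul_eq_zero.1 e).resolve_left (pow_ne_zero _ htc) : x / t ∈ Z _)
    rw [mem_closedBall_zero_iff, norm_div, Complex.norm_real, Real.norm_eq_abs,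
      abs_of_nonneg ht.1, div_le_iff₀ (lt_of_le_of_ne ht.1 ht0.symm)] at hy
    rw [mem_closedBall_zero_iff]
    nlinarith [ht.2]

theorem dF_le_of_perm {m : ℕ} {u v : Fin m → ℂ} {U V : Multiset ℂ} (hu : Enumerates u U)
    (hv : Enumerates v V) (σ : Equiv.Perm (Fin m)) {M : ℝ} (h : ∀ i, ‖u i - v (σ i)‖ ≤ M) :
    dF U V ≤ ENNReal.ofReal M := by
  rw [dF_eq_dFTuple hu hv]
  refine iInf_le_of_le σ (iSup_le fun i => ?_)
  rw [edist_dist, dist_eq_norm]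
  exact ENNReal.ofReal_le_ofReal (h i)

theorem dF_dop_le {n : ℕ} {s : ℕ → ℂ} (hs : s 0 ≠ 0) {f : ℂ[X]} (hf : f ≠ 0) {R : ℝ} (hR : 0 < R)
    (h : Z (dop n s (X ^ f.natDegree)) ⊆ Metric.closedBall 0 R) :
    dF f.roots (dop n s f).roots ≤ ENNReal.ofReal (f.natDegree * (2 * R) + R) := by
  set c := s 0 * f.leadingCoeff with hc
  have hc0 : c ≠ 0 := mul_ne_zero hs (leadingCoeff_ne_zero.2 hf)
  have hs0 : ∀ t, scaleCoeff s t 0 = s 0 := fun t => by simp [scaleCoeff]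
  have hs0' : ∀ t, scaleCoeff s t 0 ≠ 0 := fun t => by rw [hs0]; exact hs
  -- The leading coefficient `c` does not depend on `t`, so one scalar makes the whole family monic.
  let p : ℝ → ℂ[X] := fun t => C c⁻¹ * dop n (scaleCoeff s t) f
  have hroots : ∀ t, (p t).roots = (dop n (scaleCoeff s t) f).roots := fun t =>
    roots_C_mul _ (inv_ne_zero hc0)
  have hp0 : (p 0).roots = f.roots := by
    rw [hroots, dop_apply, Finset.sum_range_succ',
      Finset.sum_eq_zero (fun j _ => by simp [scaleCoeff]), zero_add, hs0, smul_eq_C_mul]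
    exact roots_C_mul _ hs
  have hp1 : (p 1).roots = (dop n s f).roots := by
    rw [hroots]
    congr 3
    funext j
    simp [scaleCoeff]
  have hdeg : ∀ t, (p t).natDegree = f.natDegree := fun t => by
    rw [natDegree_C_mul (inv_ne_zero hc0)]
    exact natDegree_eq_of_degree_eq (degree_dop n _ (hs0' t) f)
  have hcard : ∀ t, (p t).roots.card = f.natDegree := fun t => by
    rw [← hdeg t]
    exact (IsAlgClosed.splits (p t)).natDegree_eq_card_roots.symm
  obtain ⟨z, hz⟩ := exists_enumerates (hcard 0)
  obtain ⟨v, hv⟩ := exists_enumerates (hcard 1)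
  have hmonic : ∀ t, (p t).Monic := fun t => by
    rw [Monic, leadingCoeff_mul, leadingCoeff_C, leadingCoeff_dop n _ (hs0' t), hs0, ← hc,
      inv_mul_cancel₀ hc0]
  have hcont : ∀ x, Continuous fun t => (p t).eval x := fun x => by
    simp only [p, dop_apply, eval_mul, eval_C, eval_finsetSum, eval_smul, scaleCoeff]
    fun_prop
  have hnear : ∀ t ∈ Set.Icc (0 : ℝ) 1, ∀ x, (p t).eval x = 0 → ∃ i, ‖x - z i‖ ≤ R := by
    intro t ht x hx
    have hx' : x ∈ Z (dop n (scaleCoeff s t) f) := by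
      rw [eval_mul, eval_C] at hx
      exact (mul_eq_zero.1 hx).resolve_left (inv_ne_zero hc0)
    obtain ⟨y, hy, w, hw, rfl⟩ := Z_dop_subset (hs0' t) hf
      (Or.inl ⟨0, R, hR, Or.inr (Or.inl rfl)⟩) (Z_dop_scaleCoeff_subset hs hR.le h ht) hx'
    have hy' : y ∈ Finset.univ.val.map z := by
      rw [hz, hp0]; exact (mem_roots hf).2 hy
    obtain ⟨i, -, rfl⟩ := Multiset.mem_map.1 hy'
    exact ⟨i, by simpa using hw⟩
  obtain ⟨σ, hσ⟩ := exists_perm_of_family p hmonic hdeg hcont hz hv hR hnear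
  rw [← hp0, ← hp1]
  exact dF_le_of_perm hz hv σ hσ

theorem KF_lt_top_of_mem_DAlg {n : ℕ} {T : Op n} (h : T ∈ DAlg n) (hT : IsUnit T) :
    PreservesDegree T ∧ KF T < ⊤ := by
  obtain ⟨s, hs⟩ := mem_DAlg_iff.1 h
  have h0 := ne_zero_of_isUnit hs hT
  refine ⟨fun f => by rw [hs]; exact degree_dop n s h0 f, ?_⟩
  obtain ⟨R, hR0, hR⟩ := (finite_iUnion_Z_dop (n := n) h0).isBounded.subset_closedBall_lt 0 0
  refine lt_of_le_of_lt (iSup₂_le fun f hf => ?_)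
    (ENNReal.ofReal_lt_top (r := n * (2 * R) + R))
  have hf0 : (f : ℂ[X]) ≠ 0 := by intro h; simp [h] at hf
  have hd : (f : ℂ[X]).natDegree ≤ n := natDegree_le_of_degree_le (mem_degreeLE.1 f.2)
  rw [hs]
  refine (dF_dop_le h0 hf0 hR0 (subset_trans ?_ hR)).trans (ENNReal.ofReal_le_ofReal ?_)
  · refine Set.subset_biUnion_of_mem (u := fun m => Z (dop n s (X ^ m))) ?_
    simpa [Nat.lt_succ_iff] using hd
  · gcongr

end RootDistance

theorem theorem11p1 (n : ℕ) (hn : 0 < n) (T : RootDistance.Op n) (hT : T ≠ 0) :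
    List.TFAE [
      T ∈ RootDistance.DAlg n ∧ IsUnit T,
      RootDistance.IsGrace T,
      RootDistance.Kh T < ⊤,
      RootDistance.Km T < ⊤,
      IsUnit T ∧ T * RootDistance.D n = RootDistance.D n * T,
      RootDistance.KH T < ⊤,
      RootDistance.PreservesDegree T ∧ RootDistance.KF T < ⊤] := by
  open RootDistance in
  tfae_have 1 → 2 := fun h => isGrace_of_mem_DAlg h.1 h.2
  tfae_have 2 → 3 := Kh_lt_top_of_isGrace
  tfae_have 3 → 4 := (Km_le_Kh T).trans_lt
  tfae_have 4 → 1 := fun h => ⟨mem_DAlg_of_Km_lt_top h, isUnit_of_Km_lt_top h⟩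
  tfae_have 5 ↔ 1 := mem_DAlg_and_isUnit_iff
  tfae_have 1 → 6 := fun h => KH_lt_top_of_mem_DAlg h.1 h.2
  tfae_have 6 → 3 := (Kh_le_KH T).trans_lt
  tfae_have 1 → 7 := fun h => KF_lt_top_of_mem_DAlg h.1 h.2
  tfae_have 7 → 4 := fun h => Km_lt_top_of_KF h.1 h.2
  tfae_finish
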